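/- Let $m\in\mathbb{N}$. A bounded matrix-valued Jacobi operator on $\ell^2(\mathbb{Z})^m$ is an operator $$(Hf)(k)=A(k)f(k+1)+A(k-1)f(k-1)+B(k)f(k),\qquad k\in\mathbb{Z},\ f\in\ell^2(\mathbb{Z})^m,$$ where $A(k),B(k)\in\mathbb{C}^{m\times m}$ satisfy $A(k)=A(k)^*>0$ (positive definite), $B(k)=B(k)^*$ for all $k\in\mathbb{Z}$, and $\sup_{k\in\mathbb{Z}}(\|A(k)\|+\|B(k)\|)<\infty$. Such an $H$ is bounded and self-adjoint; for $z\in\mathbb{C}\setminus\mathbb{R}$ and $k,\ell\in\mathbb{Z}$ let $G(z,k,\ell)=(H-z)^{-1}(k,\ell)\in\mathbb{C}^{m\times m}$ be its Green's matrix (the $(k,\ell)$ block of the resolvent), and let $g(z,k)=G(z,k,k)$. Fix $k_0\in\mathbb{Z}$. Then each of the following three sets of data uniquely determines $H$, and hence all coefficients $A(k)$, $B(k)$, $k\in\mathbb{Z}$, among bounded matrix-valued Jacobi operators on $\ell^2(\mathbb{Z})^m$: (i) $g(z,k_0)$ and $G(z,k_0,k_0+1)$ for all $z\in\mathbb{C}_+$;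 (ii) $g(z,k_0)$ and $G(z,k_0,k_0+1)+G(z,k_0+1,k_0)$ for all $z\in\mathbb{C}_+$; (iii) $g(z,k_0)$ and $g(z,k_0+1)$ for all $z\in\mathbb{C}_+$, together with $A(k_0)$. That is, if two such operators $H_1,H_2$ (with the same $m$) have the same data (i), or the same data (ii), or the same data (iii), then $H_1=H_2$, $A_1(k)=A_2(k)$ and $B_1(k)=B_2(k)$ for all $k\in\mathbb{Z}$. -/

import Mathlib

/-!
All three data sets reduce to the first one, and the first one is read off the powers of `H`.

If a continuous linear functional takes the same values at the resolvents of `H₁` and `H₂` near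
`∞`, the expansion at `∞` shows that it takes the same values at all powers of `H₁` and `H₂`. For
`(i)` this gives the `(k₀, k₀)` and `(k₀, k₀ + 1)` blocks of all `Hⁿ`. The row `k₀` of `Hⁿ⁺¹` is a
three-term combination of the row `k₀` of `Hⁿ`, which is supported within distance `n` of `k₀`, with
invertible outermost block. So the next `B` and the square of the next `A` can be computed site by
site, and a positive definite matrix is determined by its square.

Let `P` be the projection onto the sites to the right of `k₀`. Sandwiching `[H, P]`, which only
involves `A(k₀)`, between two resolvents relates the blocks of the resolvent at `k₀` and `k₀ + 1`.
For `(ii)` and `(iii)` the relation says that the difference `X` of the two unknown blocks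
`G(z, k₀, k₀ + 1)` solves a homogeneous Sylvester equation `P(z) X + X Q(z) = 0`. Near `∞` this is a
perturbation of `A X + X A = 0`, respectively of `X = 0`, so `X = 0`.
-/

/-- The Hilbert space `ℓ²(ℤ)^m` of square-summable sequences `ℤ → ℂ^m`
(with the Euclidean norm on `ℂ^m`). -/
abbrev JacobiSpace (m : ℕ) : Type :=
  lp (fun _ : ℤ => EuclideanSpace ℂ (Fin m)) 2

open scoped ComplexOrder in
/-- Coefficients of a bounded matrix-valued Jacobi operator: two-sided sequences of `m × m` matrices
with `A k` self-adjoint and positive definite, `B k` self-adjoint, and `‖A k‖ + ‖B k‖` bounded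
uniformly in `k` (operator norm induced by the Euclidean norm on `ℂ^m`). -/
structure JacobiCoeff (m : ℕ) where
  A : ℤ → Matrix (Fin m) (Fin m) ℂ
  B : ℤ → Matrix (Fin m) (Fin m) ℂ
  A_posDef : ∀ k, (A k).PosDef
  B_isHermitian : ∀ k, (B k).IsHermitian
  bounded : ∃ C : ℝ, 0 < C ∧ ∀ k,
    ‖Matrix.toEuclideanCLM (𝕜 := ℂ) (A k)‖ + ‖Matrix.toEuclideanCLM (𝕜 := ℂ) (B k)‖ ≤ C

theorem memlp_weightedShift {m : ℕ}
    (T : ℤ → (EuclideanSpace ℂ (Fin m) →L[ℂ] EuclideanSpace ℂ (Fin m)))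
    (hT : ∃ C : ℝ, ∀ k, ‖T k‖ ≤ C) (s : ℤ) (f : JacobiSpace m) :
    Memℓp (fun k : ℤ => T k (f (k + s))) 2 := by
  obtain ⟨C, hC⟩ := hT
  have hf : Summable fun k : ℤ => ‖f k‖ ^ (2 : ENNReal).toReal :=
    (lp.memℓp f).summable (by norm_num)
  have hs : Summable fun k : ℤ => ‖f (k + s)‖ ^ (2 : ENNReal).toReal :=
    hf.comp_injective (add_left_injective s)
  refine memℓp_gen (Summable.of_nonneg_of_le (fun k => by positivity) (fun k => ?_)
    (hs.mul_left (C ^ (2 : ENNReal).toReal)))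
  rw [← Real.mul_rpow ((norm_nonneg _).trans (hC k)) (norm_nonneg _)]
  exact Real.rpow_le_rpow (norm_nonneg _)
    (((T k).le_opNorm _).trans (mul_le_mul_of_nonneg_right (hC k) (norm_nonneg _))) (by simp)

theorem norm_weightedShift_le {m : ℕ}
    (T : ℤ → (EuclideanSpace ℂ (Fin m) →L[ℂ] EuclideanSpace ℂ (Fin m)))
    (hT : ∃ C : ℝ, ∀ k, ‖T k‖ ≤ C) (s : ℤ) :
    ∃ C : ℝ, ∀ f : JacobiSpace m,
      ‖(⟨fun k : ℤ => T k (f (k + s)), memlp_weightedShift T hT s f⟩ : JacobiSpace m)‖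
        ≤ C * ‖f‖ := by
  have hT' := hT
  obtain ⟨C, hC⟩ := hT'
  have hC0 : 0 ≤ C := (norm_nonneg _).trans (hC 0)
  refine ⟨C, fun f => ?_⟩
  have h2 : 0 < (2 : ENNReal).toReal := by norm_num
  have hf : Summable fun k : ℤ => ‖f k‖ ^ (2 : ENNReal).toReal := (lp.memℓp f).summable h2
  have hs : Summable fun k : ℤ => ‖f (k + s)‖ ^ (2 : ENNReal).toReal :=
    hf.comp_injective (add_left_injective s)
  refine lp.norm_le_of_tsum_le h2 (by positivity) ?_
  have hsum : ∑' k : ℤ, ‖f (k + s)‖ ^ (2 : ENNReal).toReal = ‖f‖ ^ (2 : ENNReal).toReal := by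
    rw [lp.norm_rpow_eq_tsum h2 f]
    exact (Equiv.addRight s).tsum_eq (fun k : ℤ => ‖f k‖ ^ (2 : ENNReal).toReal)
  rw [Real.mul_rpow hC0 (norm_nonneg _), ← hsum, ← tsum_mul_left]
  refine Summable.tsum_le_tsum (fun k => ?_) ((memlp_weightedShift T hT s f).summable h2)
    (hs.mul_left _)
  rw [← Real.mul_rpow hC0 (norm_nonneg _)]
  exact Real.rpow_le_rpow (norm_nonneg _)
    (((T k).le_opNorm _).trans (mul_le_mul_of_nonneg_right (hC k) (norm_nonneg _))) h2.le

/-- The bounded operator `f ↦ (k ↦ T k (f (k + s)))` on `ℓ²(ℤ)^m`, for bounded `T`. -/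
noncomputable def weightedShift {m : ℕ}
    (T : ℤ → (EuclideanSpace ℂ (Fin m) →L[ℂ] EuclideanSpace ℂ (Fin m)))
    (hT : ∃ C : ℝ, ∀ k, ‖T k‖ ≤ C) (s : ℤ) : JacobiSpace m →L[ℂ] JacobiSpace m :=
  LinearMap.mkContinuousOfExistsBound
    { toFun := fun f => ⟨fun k : ℤ => T k (f (k + s)), memlp_weightedShift T hT s f⟩
      map_add' := fun f g => by
        ext1; funext k; exact (T k).map_add (f (k + s)) (g (k + s))
      map_smul' := fun c f => by
        ext1; funext k; exact (T k).map_smul c (f (k + s)) }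
    (norm_weightedShift_le T hT s)

theorem JacobiCoeff.bounded_A {m : ℕ} (J : JacobiCoeff m) :
    ∃ C : ℝ, ∀ k, ‖Matrix.toEuclideanCLM (𝕜 := ℂ) (J.A k)‖ ≤ C := by
  obtain ⟨C, -, hC⟩ := J.bounded
  exact ⟨C, fun k => (le_add_of_nonneg_right (norm_nonneg _)).trans (hC k)⟩

theorem JacobiCoeff.bounded_A_pred {m : ℕ} (J : JacobiCoeff m) :
    ∃ C : ℝ, ∀ k : ℤ, ‖Matrix.toEuclideanCLM (𝕜 := ℂ) (J.A (k - 1))‖ ≤ C := by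
  obtain ⟨C, hC⟩ := J.bounded_A
  exact ⟨C, fun k => hC (k - 1)⟩

theorem JacobiCoeff.bounded_B {m : ℕ} (J : JacobiCoeff m) :
    ∃ C : ℝ, ∀ k, ‖Matrix.toEuclideanCLM (𝕜 := ℂ) (J.B k)‖ ≤ C := by
  obtain ⟨C, -, hC⟩ := J.bounded
  exact ⟨C, fun k => (le_add_of_nonneg_left (norm_nonneg _)).trans (hC k)⟩

/-- The Jacobi operator `H = A S⁺ + A⁻ S⁻ + B`, a bounded operator on all of `ℓ²(ℤ)^m`. -/
noncomputable def JacobiCoeff.op {m : ℕ} (J : JacobiCoeff m) :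
    JacobiSpace m →L[ℂ] JacobiSpace m :=
  weightedShift (fun k => Matrix.toEuclideanCLM (𝕜 := ℂ) (J.A k)) J.bounded_A 1
    + weightedShift (fun k => Matrix.toEuclideanCLM (𝕜 := ℂ) (J.A (k - 1))) J.bounded_A_pred (-1)
    + weightedShift (fun k => Matrix.toEuclideanCLM (𝕜 := ℂ) (J.B k)) J.bounded_B 0

/-- `(H f)(k) = A(k) f(k+1) + A(k-1) f(k-1) + B(k) f(k)`. -/
theorem JacobiCoeff.op_apply {m : ℕ} (J : JacobiCoeff m) (f : JacobiSpace m) (k : ℤ) :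
    J.op f k = Matrix.toEuclideanCLM (𝕜 := ℂ) (J.A k) (f (k + 1))
      + Matrix.toEuclideanCLM (𝕜 := ℂ) (J.A (k - 1)) (f (k - 1))
      + Matrix.toEuclideanCLM (𝕜 := ℂ) (J.B k) (f k) := by
  have h : J.op f k = Matrix.toEuclideanCLM (𝕜 := ℂ) (J.A k) (f (k + 1))
      + Matrix.toEuclideanCLM (𝕜 := ℂ) (J.A (k - 1)) (f (k + -1))
      + Matrix.toEuclideanCLM (𝕜 := ℂ) (J.B k) (f (k + 0)) := rfl
  rw [h, add_zero, ← sub_eq_add_neg]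

/-- The Green's matrix `G(z,k,ℓ) = (H - z)⁻¹(k,ℓ)`: the `m × m` matrix whose `(i,j)` entry is the
`i`-th component at site `k` of `(H - z)⁻¹` applied to the sequence supported at site `ℓ` with value
the `j`-th standard basis vector. `Ring.inverse` is the inverse in the algebra of bounded operators;
it is the genuine inverse for all non-real `z`, as `H` is self-adjoint. -/
noncomputable def JacobiCoeff.green {m : ℕ} (J : JacobiCoeff m) (z : ℂ) (k l : ℤ) :
    Matrix (Fin m) (Fin m) ℂ :=
  Matrix.of fun i j =>
    (Ring.inverse (J.op - z • (1 : JacobiSpace m →L[ℂ] JacobiSpace m))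
      (lp.single 2 l (EuclideanSpace.single j (1 : ℂ)))) k i

/-- The diagonal Green's matrix `g(z,k) = G(z,k,k)`. -/
noncomputable def JacobiCoeff.diagGreen {m : ℕ} (J : JacobiCoeff m) (z : ℂ) (k : ℤ) :
    Matrix (Fin m) (Fin m) ℂ :=
  J.green z k k

open Filter Topology Bornology

section Resolvent

variable {R 𝔸 : Type*} [CommRing R] [Ring 𝔸] [Algebra R 𝔸] {a : 𝔸} {z : R}

theorem pow_succ_mul_resolvent (hz : z ∈ resolventSet R a) (n : ℕ) :
    a ^ (n + 1) * resolvent a z = z • (a ^ n * resolvent a z) - a ^ n := by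
  have h : a * resolvent a z = z • resolvent a z - 1 := by
    have hr : (algebraMap R 𝔸 z - a) * resolvent a z = 1 := Ring.mul_inverse_cancel _ hz
    rw [← hr, sub_mul, Algebra.smul_def, sub_sub_cancel]
  rw [pow_succ, mul_assoc, h, mul_sub, mul_smul_comm, mul_one]

theorem resolvent_mul_commutator_mul_resolvent (hz : z ∈ resolventSet R a) (p : 𝔸) :
    resolvent a z * (a * p - p * a) * resolvent a z = resolvent a z * p - p * resolvent a z := by
  have h : a * p - p * a = p * (algebraMap R 𝔸 z - a) - (algebraMap R 𝔸 z - a) * p := by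
    rw [mul_sub, sub_mul, Algebra.commutes]; abel
  have hl : resolvent a z * (algebraMap R 𝔸 z - a) = 1 := Ring.inverse_mul_cancel _ hz
  have hr : (algebraMap R 𝔸 z - a) * resolvent a z = 1 := Ring.mul_inverse_cancel _ hz
  rw [h, mul_sub, sub_mul, ← mul_assoc _ _ p, hl, one_mul, mul_assoc _ (p * _), mul_assoc p, hr,
    mul_one]

end Resolvent

section ResolventAtInfinity

variable {𝕜 𝔸 : Type*} [NontriviallyNormedField 𝕜] [NormedRing 𝔸] [NormedAlgebra 𝕜 𝔸]
  [CompleteSpace 𝔸]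

theorem eventually_mem_resolventSet (a : 𝔸) : ∀ᶠ z in cobounded 𝕜, z ∈ resolventSet 𝕜 a :=
  (spectrum.eventually_isUnit_resolvent a).mono fun _ => spectrum.isUnit_resolvent.mpr

theorem tendsto_smul_pow_mul_resolvent (a : 𝔸) (n : ℕ) :
    Tendsto (fun z : 𝕜 => z • (a ^ n * resolvent a z)) (cobounded 𝕜) (𝓝 (a ^ n)) := by
  have h : Tendsto (fun z : 𝕜 => a ^ (n + 1) * resolvent a z + a ^ n) (cobounded 𝕜)
      (𝓝 (a ^ n)) := by
    simpa using ((spectrum.resolvent_tendsto_cobounded a).const_mul (a ^ (n + 1))).add_const (a ^ n)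
  refine h.congr' ((eventually_mem_resolventSet a).mono fun z hz => ?_)
  rw [pow_succ_mul_resolvent hz, sub_add_cancel]

variable {F : Type*} [AddCommGroup F] [Module 𝕜 F] [TopologicalSpace F] [T2Space F]
  {l : Filter 𝕜} [l.NeBot] {a b : 𝔸} {φ : 𝔸 →L[𝕜] F}

theorem map_pow_eq_of_eventually_map_pow_mul_resolvent_eq (hl : l ≤ cobounded 𝕜) {n : ℕ}
    (h : ∀ᶠ z in l, φ (a ^ n * resolvent a z) = φ (b ^ n * resolvent b z)) :
    φ (a ^ n) = φ (b ^ n) := by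
  have lim (c : 𝔸) : Tendsto (fun z : 𝕜 => φ (z • (c ^ n * resolvent c z))) l (𝓝 (φ (c ^ n))) :=
    (φ.continuous.tendsto _).comp ((tendsto_smul_pow_mul_resolvent c n).mono_left hl)
  refine tendsto_nhds_unique_of_eventuallyEq (lim a) (lim b) (h.mono fun z hz => ?_)
  simp only [map_smul, hz]

theorem map_pow_eq_of_eventually_map_resolvent_eq (hl : l ≤ cobounded 𝕜)
    (h : ∀ᶠ z in l, φ (resolvent a z) = φ (resolvent b z)) (n : ℕ) : φ (a ^ n) = φ (b ^ n) := by
  refine map_pow_eq_of_eventually_map_pow_mul_resolvent_eq hl ?_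
  induction n with
  | zero => simpa using h
  | succ n ih =>
    filter_upwards [ih, hl (eventually_mem_resolventSet a), hl (eventually_mem_resolventSet b)]
      with z hz ha hb
    rw [pow_succ_mul_resolvent ha, pow_succ_mul_resolvent hb, map_sub, map_sub, map_smul, map_smul,
      hz, map_pow_eq_of_eventually_map_pow_mul_resolvent_eq hl ih]

end ResolventAtInfinity

section Sylvester

theorem mul_sub_add_sub_mul_eq_zero {R : Type*} [Ring R] {a g x x' y y' : R}
    (h : g * a * y - x * a * g = 0) (h' : g * a * y' - x' * a * g = 0) (hsum : x + y = x' + y') :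
    g * a * (x - x') + (x - x') * (a * g) = 0 := by
  obtain rfl : y = x' + y' - x := eq_sub_of_add_eq' hsum
  rw [← sub_eq_zero.mpr (h'.trans h.symm)]
  noncomm_ring

theorem eventually_forall_eq_zero_of_mul_add_mul_eq_zero (𝕜 : Type*) {𝔸 α : Type*}
    [NontriviallyNormedField 𝕜] [CompleteSpace 𝕜] [NormedRing 𝔸] [NormedAlgebra 𝕜 𝔸]
    [FiniteDimensional 𝕜 𝔸] {l : Filter α} {p q : α → 𝔸} {p₀ q₀ : 𝔸}
    (hp : Tendsto p l (𝓝 p₀)) (hq : Tendsto q l (𝓝 q₀))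
    (h : ∀ x, p₀ * x + x * q₀ = 0 → x = 0) :
    ∀ᶠ t in l, ∀ x, p t * x + x * q t = 0 → x = 0 := by
  let sylvester (u v : 𝔸) : 𝔸 →L[𝕜] 𝔸 :=
    ContinuousLinearMap.mul 𝕜 𝔸 u + (ContinuousLinearMap.mul 𝕜 𝔸).flip v
  have lim : Tendsto (fun t => sylvester (p t) (q t)) l (𝓝 (sylvester p₀ q₀)) :=
    (((ContinuousLinearMap.mul 𝕜 𝔸).continuous.tendsto p₀).comp hp).add
      (((ContinuousLinearMap.mul 𝕜 𝔸).flip.continuous.tendsto q₀).comp hq)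
  have inj : Function.Injective (sylvester p₀ q₀) := (injective_iff_map_eq_zero _).mpr h
  filter_upwards [lim.eventually (ContinuousLinearMap.isOpen_injective.mem_nhds inj)] with t ht
  exact (injective_iff_map_eq_zero _).mp ht

open scoped ComplexOrder

variable {𝕜 n : Type*} [RCLike 𝕜] [Fintype n]

theorem eq_zero_of_posDef_mul_add_mul_posSemidef {k : Type*} [Fintype k] {A : Matrix n n 𝕜}
    {C : Matrix k k 𝕜} {X : Matrix n k 𝕜} (hA : A.PosDef) (hC : C.PosSemidef)
    (h : A * X + X * C = 0) : X = 0 := by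
  have hXAX := hA.posSemidef.conjTranspose_mul_mul_same X
  have hXCX := hC.mul_mul_conjTranspose_same X
  have trace_add : (X.conjTranspose * A * X).trace + (X * C * X.conjTranspose).trace = 0 := by
    rw [Matrix.trace_mul_comm (X * C), ← Matrix.trace_add, Matrix.mul_assoc, ← Matrix.mul_add, h,
      Matrix.mul_zero, Matrix.trace_zero]
  have XAX_eq_zero : X.conjTranspose * A * X = 0 := hXAX.trace_eq_zero_iff.mp
    ((add_eq_zero_iff_of_nonneg hXAX.trace_nonneg hXCX.trace_nonneg).mp trace_add).1
  refine Matrix.mulVec_injective (funext fun v => ?_)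
  rw [Matrix.zero_mulVec]
  by_contra hv
  refine (hA.dotProduct_mulVec_pos hv).ne' ?_
  rw [Matrix.star_mulVec, ← Matrix.dotProduct_mulVec, Matrix.mulVec_mulVec, Matrix.mulVec_mulVec,
    XAX_eq_zero, Matrix.zero_mulVec, dotProduct_zero]

open scoped MatrixOrder Matrix.Norms.L2Operator in
theorem eq_of_posSemidef_of_mul_self_eq {A C : Matrix n n ℂ} (hA : A.PosSemidef)
    (hC : C.PosSemidef) (h : A * A = C * C) : A = C := by
  classical
  rw [← CFC.sqrt_mul_self A hA.nonneg, h, CFC.sqrt_mul_self C hC.nonneg]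

end Sylvester

section HalfLine

variable {R : Type*} [Ring R]

/-- `M n j` is the `(0, j)` entry of the `n`-th power of a Jacobi matrix with off-diagonal entries
`a j` (between `j` and `j + 1`) and diagonal entries `b j`. The recurrence is only required for the
columns `j + 1`, so that column `0` may couple to a second half-line. -/
structure IsHalfLineMoments (a b : ℕ → R) (M : ℕ → ℕ → R) : Prop where
  zero_zero : M 0 0 = 1
  zero_succ : ∀ j, M 0 (j + 1) = 0
  succ_succ : ∀ n j, M (n + 1) (j + 1) =
    M n (j + 2) * a (j + 1) + M n j * a j + M n (j + 1) * b (j + 1)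

namespace IsHalfLineMoments

variable {a b a' b' : ℕ → R} {M M' : ℕ → ℕ → R}

theorem eq_zero_of_lt (hM : IsHalfLineMoments a b M) : ∀ {n j : ℕ}, n < j → M n j = 0
  | 0, j + 1, _ => hM.zero_succ j
  | n + 1, j + 1, h => by
    rw [hM.succ_succ, hM.eq_zero_of_lt (n := n) (by lia), hM.eq_zero_of_lt (n := n) (by lia),
      hM.eq_zero_of_lt (n := n) (by lia)]
    simp

theorem succ_self (hM : IsHalfLineMoments a b M) (j : ℕ) :
    M (j + 1) (j + 1) = M j j * a j := by
  rw [hM.succ_succ, hM.eq_zero_of_lt (n := j) (j := j + 2) (by lia),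
    hM.eq_zero_of_lt (n := j) (j := j + 1) (by lia)]
  simp

theorem isUnit_self (hM : IsHalfLineMoments a b M) (ha : ∀ j, IsUnit (a j)) :
    ∀ j, IsUnit (M j j)
  | 0 => hM.zero_zero ▸ isUnit_one
  | j + 1 => hM.succ_self j ▸ (hM.isUnit_self ha j).mul (ha j)

theorem diag_succ_eq (hM : IsHalfLineMoments a b M) (hM' : IsHalfLineMoments a' b' M')
    (ha : ∀ j, IsUnit (a j)) {j : ℕ} (haj : a j = a' j) (hj : ∀ n, M n j = M' n j)
    (hj' : ∀ n, M n (j + 1) = M' n (j + 1)) : b (j + 1) = b' (j + 1) := by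
  have h := hj' (j + 2)
  rw [hM.succ_succ, hM'.succ_succ, hM.eq_zero_of_lt (by lia), hM'.eq_zero_of_lt (by lia), zero_mul,
    zero_mul, hj, haj, ← hj' (j + 1)] at h
  exact (hM.isUnit_self ha (j + 1)).mul_left_cancel (add_left_cancel h)

theorem offDiag_succ_eq (hM : IsHalfLineMoments a b M) (hM' : IsHalfLineMoments a' b' M')
    (ha : ∀ j, IsUnit (a j)) {j : ℕ} (hsq : a (j + 1) * a (j + 1) = a' (j + 1) * a' (j + 1) →
      a (j + 1) = a' (j + 1)) (haj : a j = a' j) (hj : ∀ n, M n j = M' n j)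
    (hj' : ∀ n, M n (j + 1) = M' n (j + 1)) :
    a (j + 1) = a' (j + 1) ∧ ∀ n, M n (j + 2) = M' n (j + 2) := by
  have col_mul (n : ℕ) : M n (j + 2) * a (j + 1) = M' n (j + 2) * a' (j + 1) := by
    have h := hj' (n + 1)
    rw [hM.succ_succ, hM'.succ_succ, hj, haj, hj', hM.diag_succ_eq hM' ha haj hj hj'] at h
    exact add_right_cancel (add_right_cancel h)
  have ha_succ : a (j + 1) = a' (j + 1) := by
    refine hsq ((hM.isUnit_self ha (j + 1)).mul_left_cancel ?_)
    have h := col_mul (j + 2)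
    rwa [hM.succ_self, hM'.succ_self, ← hj', mul_assoc, mul_assoc] at h
  exact ⟨ha_succ, fun n => (ha (j + 1)).mul_right_cancel (by rw [col_mul, ha_succ])⟩

theorem coeff_unique (hM : IsHalfLineMoments a b M) (hM' : IsHalfLineMoments a' b' M')
    (ha : ∀ j, IsUnit (a j)) (hsq : ∀ j, a j * a j = a' j * a' j → a j = a' j)
    (h0 : ∀ n, M n 0 = M' n 0) (h1 : ∀ n, M n 1 = M' n 1) (j : ℕ) :
    a j = a' j ∧ b (j + 1) = b' (j + 1) := by
  have columns (j : ℕ) :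
      a j = a' j ∧ (∀ n, M n j = M' n j) ∧ ∀ n, M n (j + 1) = M' n (j + 1) := by
    induction j with
    | zero =>
      refine ⟨?_, h0, h1⟩
      simpa [hM.succ_self, hM'.succ_self, hM.zero_zero, hM'.zero_zero] using h1 1
    | succ j ih =>
      obtain ⟨haj, hj, hj'⟩ := ih
      obtain ⟨ha_succ, hj''⟩ := hM.offDiag_succ_eq hM' ha (hsq _) haj hj hj'
      exact ⟨ha_succ, hj', hj''⟩
  obtain ⟨haj, hj, hj'⟩ := columns j
  exact ⟨haj, hM.diag_succ_eq hM' ha haj hj hj'⟩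

end IsHalfLineMoments

end HalfLine

section Blocks

variable {m : ℕ}

/-- The inclusion of `ℂ^m` into `ℓ²(ℤ)^m` as the sequences supported at site `l`. -/
noncomputable abbrev siteEmbed (m : ℕ) (l : ℤ) : EuclideanSpace ℂ (Fin m) →L[ℂ] JacobiSpace m :=
  lp.singleContinuousLinearMap ℂ (fun _ : ℤ => EuclideanSpace ℂ (Fin m)) 2 l

/-- The value of a sequence at site `k`. -/
noncomputable abbrev siteEval (m : ℕ) (k : ℤ) : JacobiSpace m →L[ℂ] EuclideanSpace ℂ (Fin m) :=
  lp.evalCLM ℂ (fun _ : ℤ => EuclideanSpace ℂ (Fin m)) 2 k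

/-- The `(k, l)` block of a bounded operator on `ℓ²(ℤ)^m`. -/
noncomputable def block (k l : ℤ) :
    (JacobiSpace m →L[ℂ] JacobiSpace m) →L[ℂ] Matrix (Fin m) (Fin m) ℂ :=
  (Matrix.toEuclideanCLM (𝕜 := ℂ) (n := Fin m)).symm.toAlgEquiv.toLinearMap.toContinuousLinearMap
    ∘L (ContinuousLinearMap.precomp _ (siteEmbed m l)
    ∘L ContinuousLinearMap.postcomp _ (siteEval m k))

theorem toEuclideanCLM_block (k l : ℤ) (T : JacobiSpace m →L[ℂ] JacobiSpace m) :
    Matrix.toEuclideanCLM (𝕜 := ℂ) (block k l T) = (siteEval m k ∘L T) ∘L siteEmbed m l :=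
  (Matrix.toEuclideanCLM (𝕜 := ℂ) (n := Fin m)).apply_symm_apply
    ((siteEval m k ∘L T) ∘L siteEmbed m l)

theorem toEuclideanCLM_block_apply (k l : ℤ) (T : JacobiSpace m →L[ℂ] JacobiSpace m)
    (v : EuclideanSpace ℂ (Fin m)) :
    Matrix.toEuclideanCLM (𝕜 := ℂ) (block k l T) v = T (lp.single 2 l v) k := by
  rw [toEuclideanCLM_block]
  rfl

theorem block_eq_of_forall {k l : ℤ} {T : JacobiSpace m →L[ℂ] JacobiSpace m}
    {M : Matrix (Fin m) (Fin m) ℂ}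
    (h : ∀ v, T (lp.single 2 l v) k = Matrix.toEuclideanCLM (𝕜 := ℂ) M v) : block k l T = M :=
  EquivLike.injective (Matrix.toEuclideanCLM (𝕜 := ℂ) (n := Fin m)) <|
    ContinuousLinearMap.ext fun v => (toEuclideanCLM_block_apply k l T v).trans (h v)

theorem block_apply (k l : ℤ) (T : JacobiSpace m →L[ℂ] JacobiSpace m) (i j : Fin m) :
    block k l T i j = T (lp.single 2 l (EuclideanSpace.single j 1)) k i := by
  rw [← toEuclideanCLM_block_apply, Matrix.ofLp_toEuclideanCLM]
  simp

theorem block_one (k l : ℤ) :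
    block k l (1 : JacobiSpace m →L[ℂ] JacobiSpace m) = if k = l then 1 else 0 := by
  refine block_eq_of_forall fun v => ?_
  rcases eq_or_ne k l with rfl | h
  · simp
  · simp [h]

theorem weightedShift_apply
    (T : ℤ → (EuclideanSpace ℂ (Fin m) →L[ℂ] EuclideanSpace ℂ (Fin m)))
    (hT : ∃ C : ℝ, ∀ k, ‖T k‖ ≤ C) (s : ℤ) (f : JacobiSpace m) (k : ℤ) :
    weightedShift T hT s f k = T k (f (k + s)) := rfl

theorem weightedShift_single
    (T : ℤ → (EuclideanSpace ℂ (Fin m) →L[ℂ] EuclideanSpace ℂ (Fin m)))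
    (hT : ∃ C : ℝ, ∀ k, ‖T k‖ ≤ C) (s l : ℤ) (v : EuclideanSpace ℂ (Fin m)) :
    weightedShift T hT s (lp.single 2 l v) = lp.single 2 (l - s) (T (l - s) v) := by
  ext1; funext k
  rw [weightedShift_apply]
  rcases eq_or_ne k (l - s) with rfl | h
  · simp
  · simp [h, show k + s ≠ l by lia]

/-- The operator on `ℓ²(ℤ)^m` whose only nonzero block is `M`, in position `(p, q)`. -/
noncomputable def blockSingle (p q : ℤ) (M : Matrix (Fin m) (Fin m) ℂ) :
    JacobiSpace m →L[ℂ] JacobiSpace m :=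
  siteEmbed m p ∘L Matrix.toEuclideanCLM (𝕜 := ℂ) M ∘L siteEval m q

theorem blockSingle_apply (p q : ℤ) (M : Matrix (Fin m) (Fin m) ℂ) (f : JacobiSpace m) :
    blockSingle p q M f = lp.single 2 p (Matrix.toEuclideanCLM (𝕜 := ℂ) M (f q)) := rfl

theorem block_mul_blockSingle_mul (S T : JacobiSpace m →L[ℂ] JacobiSpace m) (k l p q : ℤ)
    (M : Matrix (Fin m) (Fin m) ℂ) :
    block k l (S * blockSingle p q M * T) = block k p S * M * block q l T :=
  block_eq_of_forall fun v => by
    simp only [map_mul, mul_apply_eq_comp, toEuclideanCLM_block_apply,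
      blockSingle_apply]

/-- The orthogonal projection of `ℓ²(ℤ)^m` onto the sequences supported to the right of `k₀`. -/
noncomputable def rightProj (m : ℕ) (k₀ : ℤ) : JacobiSpace m →L[ℂ] JacobiSpace m :=
  weightedShift (fun k => if k₀ < k then 1 else 0)
    ⟨1, fun k => by
      split_ifs <;> simp [ContinuousLinearMap.one_def, ContinuousLinearMap.norm_id_le]⟩ 0

theorem rightProj_apply (k₀ : ℤ) (f : JacobiSpace m) (k : ℤ) :
    rightProj m k₀ f k = if k₀ < k then f k else 0 := by
  rw [rightProj, weightedShift_apply, add_zero]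
  split_ifs <;> simp

theorem rightProj_single (k₀ l : ℤ) (v : EuclideanSpace ℂ (Fin m)) :
    rightProj m k₀ (lp.single 2 l v) = if k₀ < l then lp.single 2 l v else 0 := by
  rw [rightProj, weightedShift_single, sub_zero]
  split_ifs <;> simp

theorem block_mul_rightProj (k₀ k l : ℤ) (T : JacobiSpace m →L[ℂ] JacobiSpace m) :
    block k l (T * rightProj m k₀) = if k₀ < l then block k l T else 0 :=
  block_eq_of_forall fun v => by
    rw [mul_apply_eq_comp, rightProj_single]
    split_ifs <;> simp [toEuclideanCLM_block_apply]

theorem block_rightProj_mul (k₀ k l : ℤ) (T : JacobiSpace m →L[ℂ] JacobiSpace m) :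
    block k l (rightProj m k₀ * T) = if k₀ < k then block k l T else 0 :=
  block_eq_of_forall fun v => by
    rw [mul_apply_eq_comp, rightProj_apply]
    split_ifs <;> simp [toEuclideanCLM_block_apply]

end Blocks

namespace JacobiCoeff

variable {m : ℕ} (J : JacobiCoeff m)

theorem op_single (l : ℤ) (v : EuclideanSpace ℂ (Fin m)) :
    J.op (lp.single 2 l v) = lp.single 2 (l + 1) (Matrix.toEuclideanCLM (𝕜 := ℂ) (J.A l) v)
      + lp.single 2 (l - 1) (Matrix.toEuclideanCLM (𝕜 := ℂ) (J.A (l - 1)) v)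
      + lp.single 2 l (Matrix.toEuclideanCLM (𝕜 := ℂ) (J.B l) v) := by
  simp only [op, add_apply, weightedShift_single, sub_neg_eq_add,
    add_sub_cancel_right, sub_zero]
  abel

theorem block_mul_op (T : JacobiSpace m →L[ℂ] JacobiSpace m) (k l : ℤ) :
    block k l (T * J.op) = block k (l + 1) T * J.A l + block k (l - 1) T * J.A (l - 1)
      + block k l T * J.B l :=
  block_eq_of_forall fun v => by
    simp only [mul_apply_eq_comp, op_single, map_add, map_mul, add_apply,
      lp.coeFn_add, Pi.add_apply, toEuclideanCLM_block_apply]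

theorem block_op (k l : ℤ) :
    block k l J.op = (if k = l + 1 then J.A l else 0) + (if k = l - 1 then J.A (l - 1) else 0)
      + if k = l then J.B l else 0 := by
  simpa only [one_mul, block_one, ite_mul, zero_mul] using J.block_mul_op 1 k l

theorem block_op_self (k : ℤ) : block k k J.op = J.B k := by
  simp [block_op, show k ≠ k - 1 by lia]

theorem block_op_succ_right (k : ℤ) : block k (k + 1) J.op = J.A k := by
  simp [block_op, show k ≠ k + 1 + 1 by lia]

theorem block_op_succ_left (k : ℤ) : block (k + 1) k J.op = J.A k := by
  simp [block_op, show k + 1 ≠ k - 1 by lia]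

theorem op_commutator_rightProj (k₀ : ℤ) :
    J.op * rightProj m k₀ - rightProj m k₀ * J.op
      = blockSingle k₀ (k₀ + 1) (J.A k₀) - blockSingle (k₀ + 1) k₀ (J.A k₀) := by
  ext1 f; ext1; funext k
  simp only [sub_apply, mul_apply_eq_comp, lp.coeFn_sub, Pi.sub_apply, op_apply,
    rightProj_apply, blockSingle_apply, lp.single_apply, Pi.single_apply]
  rcases lt_trichotomy k k₀ with hk | rfl | hk
  · simp [hk.ne, hk.not_gt, show ¬ k₀ < k + 1 by lia, show ¬ k₀ < k - 1 by lia,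
      show k ≠ k₀ + 1 by lia]
  · simp [show ¬ k < k - 1 by lia]
  · rcases eq_or_ne k (k₀ + 1) with rfl | hk'
    · simp [show k₀ < k₀ + 1 + 1 by lia]
    · simp [hk, hk.ne', hk', show k₀ < k + 1 by lia, show k₀ < k - 1 by lia]

theorem green_eq_neg_block_resolvent (z : ℂ) (k l : ℤ) :
    J.green z k l = -block k l (resolvent J.op z) := by
  have inverse_eq : Ring.inverse (J.op - z • (1 : JacobiSpace m →L[ℂ] JacobiSpace m))
      = -resolvent J.op z := by
    rw [resolvent, Algebra.algebraMap_eq_smul_one, ← neg_sub]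
    generalize z • (1 : JacobiSpace m →L[ℂ] JacobiSpace m) - J.op = T
    by_cases hT : IsUnit T
    · obtain ⟨u, rfl⟩ := hT
      rw [← Units.val_neg, Ring.inverse_unit, Ring.inverse_unit, inv_neg, Units.val_neg]
    · rw [Ring.inverse_non_unit _ hT, Ring.inverse_non_unit _ (by simpa using hT), neg_zero]
  ext i j
  rw [← map_neg, ← inverse_eq, block_apply]
  rfl

theorem green_mul_A_mul_green_sub {z : ℂ} (hz : z ∈ resolventSet ℂ J.op) (k₀ k l : ℤ) :
    J.green z k k₀ * J.A k₀ * J.green z (k₀ + 1) l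
      - J.green z k (k₀ + 1) * J.A k₀ * J.green z k₀ l
      = (if k₀ < k then J.green z k l else 0) - if k₀ < l then J.green z k l else 0 := by
  have h := congrArg (block k l) (resolvent_mul_commutator_mul_resolvent hz (rightProj m k₀))
  rw [op_commutator_rightProj, mul_sub, sub_mul, map_sub, map_sub, block_mul_blockSingle_mul,
    block_mul_blockSingle_mul, block_mul_rightProj, block_rightProj_mul] at h
  simp only [green_eq_neg_block_resolvent, neg_mul, mul_neg, neg_neg, h]
  split_ifs <;> abel

theorem tendsto_green (k l : ℤ) : Tendsto (fun z => J.green z k l) (cobounded ℂ) (𝓝 0) := by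
  simpa [green_eq_neg_block_resolvent, Function.comp_def] using
    (((block k l).continuous.tendsto _).comp
      (spectrum.resolvent_tendsto_cobounded (𝕜 := ℂ) J.op)).neg

theorem tendsto_neg_smul_diagGreen (k : ℤ) :
    Tendsto (fun z => -z • J.diagGreen z k) (cobounded ℂ) (𝓝 1) := by
  simpa [diagGreen, green_eq_neg_block_resolvent, Function.comp_def, block_one] using
    ((block k k).continuous.tendsto _).comp (tendsto_smul_pow_mul_resolvent (𝕜 := ℂ) J.op 0)

theorem isHalfLineMoments_right (k : ℤ) :
    IsHalfLineMoments (fun j => J.A (k + j)) (fun j => J.B (k + j))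
      fun n j => block k (k + j) (J.op ^ n) where
  zero_zero := by simp [block_one]
  zero_succ j := by rw [pow_zero, block_one, if_neg (by lia)]
  succ_succ n j := by
    rw [pow_succ, block_mul_op, show k + (j + 1 : ℕ) + 1 = k + (j + 2 : ℕ) by lia,
      show k + (j + 1 : ℕ) - 1 = k + j by lia]

theorem isHalfLineMoments_left (k : ℤ) :
    IsHalfLineMoments (fun j => J.A (k - 1 - j)) (fun j => J.B (k - j))
      fun n j => block k (k - j) (J.op ^ n) where
  zero_zero := by simp [block_one]
  zero_succ j := by rw [pow_zero, block_one, if_neg (by lia)]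
  succ_succ n j := by
    rw [pow_succ, block_mul_op, show k - (j + 1 : ℕ) + 1 = k - j by lia,
      show k - (j + 1 : ℕ) - 1 = k - (j + 2 : ℕ) by lia,
      show k - 1 - (j + 1 : ℕ) = k - (j + 2 : ℕ) by lia,
      show k - 1 - (j : ℤ) = k - (j + 1 : ℕ) by lia]
    abel

open scoped ComplexOrder in
theorem isUnit_A (k : ℤ) : IsUnit (J.A k) := (J.A_posDef k).isUnit

section Uniqueness

variable {J} {J' : JacobiCoeff m} {k₀ : ℤ}

open scoped ComplexOrder in
theorem A_eq_of_mul_self_eq {k : ℤ} (h : J.A k * J.A k = J'.A k * J'.A k) : J.A k = J'.A k :=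
  eq_of_posSemidef_of_mul_self_eq (J.A_posDef k).posSemidef (J'.A_posDef k).posSemidef h

theorem block_pow_pred_eq
    (h0 : ∀ n : ℕ, block k₀ k₀ (J.op ^ n) = block k₀ k₀ (J'.op ^ n))
    (h1 : ∀ n : ℕ, block k₀ (k₀ + 1) (J.op ^ n) = block k₀ (k₀ + 1) (J'.op ^ n)) (n : ℕ) :
    block k₀ (k₀ - 1) (J.op ^ n) = block k₀ (k₀ - 1) (J'.op ^ n) := by
  have hA : J.A k₀ = J'.A k₀ := by simpa [block_op_succ_right] using h1 1
  have hB : J.B k₀ = J'.B k₀ := by simpa [block_op_self] using h0 1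
  have col_mul (n : ℕ) : block k₀ (k₀ - 1) (J.op ^ n) * J.A (k₀ - 1)
      = block k₀ (k₀ - 1) (J'.op ^ n) * J'.A (k₀ - 1) := by
    have h := h0 (n + 1)
    rw [pow_succ, pow_succ, block_mul_op, block_mul_op, h0, h1, hA, hB] at h
    exact add_left_cancel (add_right_cancel h)
  have block_pred (K : JacobiCoeff m) : block k₀ (k₀ - 1) K.op = K.A (k₀ - 1) := by
    simpa using K.block_op_succ_left (k₀ - 1)
  have hA_pred : J.A (k₀ - 1) = J'.A (k₀ - 1) :=
    A_eq_of_mul_self_eq (by simpa [block_pred] using col_mul 1)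
  exact (J.isUnit_A (k₀ - 1)).mul_right_cancel (by rw [col_mul, hA_pred])

theorem eq_of_block_pow_eq
    (h0 : ∀ n : ℕ, block k₀ k₀ (J.op ^ n) = block k₀ k₀ (J'.op ^ n))
    (h1 : ∀ n : ℕ, block k₀ (k₀ + 1) (J.op ^ n) = block k₀ (k₀ + 1) (J'.op ^ n)) :
    J = J' := by
  have right (j : ℕ) : J.A (k₀ + j) = J'.A (k₀ + j) ∧
      J.B (k₀ + (j + 1 : ℕ)) = J'.B (k₀ + (j + 1 : ℕ)) :=
    (J.isHalfLineMoments_right k₀).coeff_unique (J'.isHalfLineMoments_right k₀)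
      (fun _ => J.isUnit_A _) (fun _ => A_eq_of_mul_self_eq) (by simpa using h0)
      (by simpa using h1) j
  have left (j : ℕ) : J.A (k₀ - 1 - j) = J'.A (k₀ - 1 - j) ∧
      J.B (k₀ - (j + 1 : ℕ)) = J'.B (k₀ - (j + 1 : ℕ)) :=
    (J.isHalfLineMoments_left k₀).coeff_unique (J'.isHalfLineMoments_left k₀)
      (fun _ => J.isUnit_A _) (fun _ => A_eq_of_mul_self_eq) (by simpa using h0)
      (by simpa using block_pow_pred_eq h0 h1) j
  have hA (k : ℤ) : J.A k = J'.A k := by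
    rcases le_or_gt k₀ k with hk | hk
    · obtain ⟨j, rfl⟩ := Int.le.dest hk
      exact (right j).1
    · obtain ⟨j, hj⟩ := Int.le.dest (show k ≤ k₀ - 1 by lia)
      rw [show k = k₀ - 1 - j by lia]
      exact (left j).1
  have hB (k : ℤ) : J.B k = J'.B k := by
    rcases lt_trichotomy k₀ k with hk | rfl | hk
    · obtain ⟨j, hj⟩ := Int.le.dest (show k₀ + 1 ≤ k by lia)
      rw [show k = k₀ + (j + 1 : ℕ) by lia]
      exact (right j).2
    · simpa [block_op_self] using h0 1
    · obtain ⟨j, hj⟩ := Int.le.dest (show k ≤ k₀ - 1 by lia)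
      rw [show k = k₀ - (j + 1 : ℕ) by lia]
      exact (left j).2
  obtain ⟨A, B⟩ := J
  obtain ⟨A', B'⟩ := J'
  obtain rfl : A = A' := funext hA
  obtain rfl : B = B' := funext hB
  rfl

variable {l : Filter ℂ} [l.NeBot]

theorem eq_of_eventually_green_eq (hl : l ≤ cobounded ℂ)
    (h0 : ∀ᶠ z in l, J.diagGreen z k₀ = J'.diagGreen z k₀)
    (h1 : ∀ᶠ z in l, J.green z k₀ (k₀ + 1) = J'.green z k₀ (k₀ + 1)) : J = J' := by
  simp only [diagGreen, green_eq_neg_block_resolvent, neg_inj] at h0 h1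
  exact eq_of_block_pow_eq (map_pow_eq_of_eventually_map_resolvent_eq hl h0)
    (map_pow_eq_of_eventually_map_resolvent_eq hl h1)

theorem A_eq_of_eventually_green_add_green_eq (hl : l ≤ cobounded ℂ)
    (h : ∀ᶠ z in l, J.green z k₀ (k₀ + 1) + J.green z (k₀ + 1) k₀
      = J'.green z k₀ (k₀ + 1) + J'.green z (k₀ + 1) k₀) : J.A k₀ = J'.A k₀ := by
  simp only [green_eq_neg_block_resolvent, ← neg_add, neg_inj] at h
  have h_op := map_pow_eq_of_eventually_map_resolvent_eq hl
    (φ := block k₀ (k₀ + 1) + block (k₀ + 1) k₀) h 1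
  simpa [block_op_succ_right, block_op_succ_left, ← two_smul ℂ] using h_op

open scoped ComplexOrder Matrix.Norms.L2Operator in
theorem eq_of_eventually_green_add_green_eq (hl : l ≤ cobounded ℂ)
    (h0 : ∀ᶠ z in l, J.diagGreen z k₀ = J'.diagGreen z k₀)
    (h1 : ∀ᶠ z in l, J.green z k₀ (k₀ + 1) + J.green z (k₀ + 1) k₀
      = J'.green z k₀ (k₀ + 1) + J'.green z (k₀ + 1) k₀) : J = J' := by
  have hA : J.A k₀ = J'.A k₀ := A_eq_of_eventually_green_add_green_eq hl h1
  refine eq_of_eventually_green_eq hl h0 ?_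
  have lim := (J.tendsto_neg_smul_diagGreen k₀).mono_left hl
  have sylvester := eventually_forall_eq_zero_of_mul_add_mul_eq_zero ℂ
    (lim.mul_const (J.A k₀)) (lim.const_mul (J.A k₀)) fun X hX =>
      eq_zero_of_posDef_mul_add_mul_posSemidef (J.A_posDef k₀) (J.A_posDef k₀).posSemidef
        (by simpa using hX)
  filter_upwards [h0, h1, hl (eventually_mem_resolventSet J.op),
    hl (eventually_mem_resolventSet J'.op), sylvester] with z hg hsum hz hz' hsyl
  have hJ := J.green_mul_A_mul_green_sub hz k₀ k₀ k₀
  have hJ' := J'.green_mul_A_mul_green_sub hz' k₀ k₀ k₀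
  simp only [diagGreen] at hg hsyl
  rw [← hA, ← hg] at hJ'
  simp only [lt_irrefl, if_false, sub_zero] at hJ hJ'
  refine sub_eq_zero.mp (hsyl _ ?_)
  rw [smul_mul_assoc, mul_smul_comm, smul_mul_assoc, mul_smul_comm, ← smul_add,
    mul_sub_add_sub_mul_eq_zero hJ hJ' hsum, smul_zero]

open scoped Matrix.Norms.L2Operator in
theorem eq_of_eventually_diagGreen_eq (hl : l ≤ cobounded ℂ)
    (h0 : ∀ᶠ z in l, J.diagGreen z k₀ = J'.diagGreen z k₀)
    (h1 : ∀ᶠ z in l, J.diagGreen z (k₀ + 1) = J'.diagGreen z (k₀ + 1))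
    (hA : J.A k₀ = J'.A k₀) : J = J' := by
  refine eq_of_eventually_green_eq hl h0 ?_
  have limJ := (J.tendsto_green k₀ (k₀ + 1)).mono_left hl
  have limJ' := (J'.tendsto_green k₀ (k₀ + 1)).mono_left hl
  have sylvester := eventually_forall_eq_zero_of_mul_add_mul_eq_zero ℂ
    ((limJ.mul_const (J.A k₀)).const_sub 1) (limJ'.const_mul (J.A k₀)).neg (by simp)
  filter_upwards [h0, h1, hl (eventually_mem_resolventSet J.op),
    hl (eventually_mem_resolventSet J'.op), sylvester] with z hg hg' hz hz' hsyl
  have hJ := J.green_mul_A_mul_green_sub hz k₀ k₀ (k₀ + 1)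
  have hJ' := J'.green_mul_A_mul_green_sub hz' k₀ k₀ (k₀ + 1)
  simp only [diagGreen] at hg hg'
  rw [← hA, ← hg, ← hg'] at hJ'
  simp only [lt_irrefl, lt_add_one, if_true, if_false, zero_sub] at hJ hJ'
  refine sub_eq_zero.mp (hsyl _ ?_)
  rw [← sub_eq_zero.mpr (congrArg₂ (· - ·) hJ hJ')]
  noncomm_ring

end Uniqueness

end JacobiCoeff

theorem not_isBounded_setOf_im_pos : ¬ IsBounded {z : ℂ | 0 < z.im} := fun h => by
  obtain ⟨C, hC⟩ := isBounded_iff_forall_norm_le.mp h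
  have im_le : |C| + 1 ≤ C :=
    (Complex.im_le_norm ⟨0, |C| + 1⟩).trans (hC _ (by positivity : 0 < |C| + 1))
  linarith [le_abs_self C]

theorem theorem4p4_general (m : ℕ) (k₀ : ℤ) (J₁ J₂ : JacobiCoeff m) {S : Set ℂ}
    (hS : ¬ IsBounded S) :
    ((∀ z ∈ S,
        J₁.diagGreen z k₀ = J₂.diagGreen z k₀ ∧
        J₁.green z k₀ (k₀ + 1) = J₂.green z k₀ (k₀ + 1)) →
      J₁.op = J₂.op ∧ J₁.A = J₂.A ∧ J₁.B = J₂.B) ∧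
    ((∀ z ∈ S,
        J₁.diagGreen z k₀ = J₂.diagGreen z k₀ ∧
        J₁.green z k₀ (k₀ + 1) + J₁.green z (k₀ + 1) k₀ =
          J₂.green z k₀ (k₀ + 1) + J₂.green z (k₀ + 1) k₀) →
      J₁.op = J₂.op ∧ J₁.A = J₂.A ∧ J₁.B = J₂.B) ∧
    ((∀ z ∈ S,
        J₁.diagGreen z k₀ = J₂.diagGreen z k₀ ∧
        J₁.diagGreen z (k₀ + 1) = J₂.diagGreen z (k₀ + 1)) →
      J₁.A k₀ = J₂.A k₀ →
      J₁.op = J₂.op ∧ J₁.A = J₂.A ∧ J₁.B = J₂.B) := by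
  have : (cobounded ℂ ⊓ 𝓟 S).NeBot := frequently_mem_iff_neBot.mp hS
  have hl : cobounded ℂ ⊓ 𝓟 S ≤ cobounded ℂ := inf_le_left
  have on_S {p : ℂ → Prop} (h : ∀ z ∈ S, p z) : ∀ᶠ z in cobounded ℂ ⊓ 𝓟 S, p z :=
    eventually_inf_principal.mpr (.of_forall h)
  have coeff_eq (h : J₁ = J₂) : J₁.op = J₂.op ∧ J₁.A = J₂.A ∧ J₁.B = J₂.B := by simp [h]
  refine ⟨fun h => coeff_eq ?_, fun h => coeff_eq ?_, fun h hA => coeff_eq ?_⟩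
  · exact JacobiCoeff.eq_of_eventually_green_eq hl
      (on_S fun z hz => (h z hz).1) (on_S fun z hz => (h z hz).2)
  · exact JacobiCoeff.eq_of_eventually_green_add_green_eq hl
      (on_S fun z hz => (h z hz).1) (on_S fun z hz => (h z hz).2)
  · exact JacobiCoeff.eq_of_eventually_diagGreen_eq hl
      (on_S fun z hz => (h z hz).1) (on_S fun z hz => (h z hz).2) hA

theorem theorem4p4 (m : ℕ) (k₀ : ℤ) (J₁ J₂ : JacobiCoeff m) :
    ((∀ z : ℂ, 0 < z.im →
        J₁.diagGreen z k₀ = J₂.diagGreen z k₀ ∧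
        J₁.green z k₀ (k₀ + 1) = J₂.green z k₀ (k₀ + 1)) →
      J₁.op = J₂.op ∧ J₁.A = J₂.A ∧ J₁.B = J₂.B) ∧
    ((∀ z : ℂ, 0 < z.im →
        J₁.diagGreen z k₀ = J₂.diagGreen z k₀ ∧
        J₁.green z k₀ (k₀ + 1) + J₁.green z (k₀ + 1) k₀ =
          J₂.green z k₀ (k₀ + 1) + J₂.green z (k₀ + 1) k₀) →
      J₁.op = J₂.op ∧ J₁.A = J₂.A ∧ J₁.B = J₂.B) ∧
    ((∀ z : ℂ, 0 < z.im →
        J₁.diagGreen z k₀ = J₂.diagGreen z k₀ ∧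
        J₁.diagGreen z (k₀ + 1) = J₂.diagGreen z (k₀ + 1)) →
      J₁.A k₀ = J₂.A k₀ →
      J₁.op = J₂.op ∧ J₁.A = J₂.A ∧ J₁.B = J₂.B) :=
  theorem4p4_general m k₀ J₁ J₂ not_isBounded_setOf_im_pos
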